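/- For $n\ge 1$, $c\in\mathbb R$, let $Q_c\in\mathbb{R}^{n\times n}$ be the matrix with unit diagonal and all off-diagonal entries equal to $c$, and for $b\in\mathbb{R}^n$ let $f(x)=x^TQ_cx-2b^Tx$, with minimum value $f^*$ (when it exists). Let $\kappa=\lambda_{\max}(Q_c)/\lambda_{\min}(Q_c)$, where $\lambda_{\min}$ is the smallest nonzero eigenvalue. Coordinate descent updates one coordinate at a time, replacing it by the exact minimizer of $f$ along that coordinate. One epoch of symmetric Gauss–Seidel coordinate descent (sGS-CD) updates the coordinates in the order $1,2,\dots,n-1,n,n-1,\dots,1$. One epoch of randomized coordinate descent (R-CD) consists of $n$ updates of coordinates drawn independently and uniformly from $\{1,\dots,n\}$. **Theorem.** There is an absolute constant $C>0$ such that the following holds. Let $n\ge2$, $x^0\in\mathbb{R}^n$ and $\delta\in(0,1]$. There is $c_0\in[0,1)$ such that for every $c\in(c_0,1)$ the matrix $Q_c$ is positive definite and there is $b\in\mathbb{R}^n$ for which the convex quadratic $f(x)=x^TQ_cx-2b^Tx$ attains its minimum $f^*$, satisfies $f(x^0)>f^*$, and has the following two properties. 1. If $x^k$ is the output of sGS-CD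 started at $x^0$ after $k$ epochs, then $$f(x^k)-f^*\ \ge\ (1-\delta)\Bigl(1-\frac{4\pi^2}{n\kappa}\Bigr)^{2k+2}\bigl(f(x^0)-f^*\bigr)\qquad\text{for all }k\ge0.$$ 2. sGS-CD is slower than R-CD by a factor of order $n^2$ on this problem: for all $\varepsilon\in(0,1/2]$ and $k\ge 0$, if $f(x^k)-f^*\le\varepsilon\,(f(x^0)-f^*)$, then there is an $m\ge 0$ with $k\ge C\,n^2\,m$ such that the output $y^m$ of R-CD started at $x^0$ after $m$ epochs satisfies $\mathbb{E}f(y^m)-f^*\le\varepsilon\,(f(x^0)-f^*)$. -/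

import Mathlib

open Matrix Set

namespace CoordDescent

/-- The quadratic function `f(x) = xᵀ Q x - 2 bᵀ x`. -/
def quadratic {n : ℕ} (Q : Matrix (Fin n) (Fin n) ℝ) (b : Fin n → ℝ) (x : Fin n → ℝ) : ℝ :=
  x ⬝ᵥ (Q *ᵥ x) - 2 * (b ⬝ᵥ x)

/-- The matrix with unit diagonal and all off-diagonal entries equal to `c`. -/
def unitDiag (n : ℕ) (c : ℝ) : Matrix (Fin n) (Fin n) ℝ :=
  Matrix.of fun i j => if i = j then 1 else c

/-- The condition number `λ_max / λ_min` of a symmetric positive semidefinite matrix: its maximum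
eigenvalue divided by its minimum nonzero eigenvalue. -/
noncomputable def condNumber {n : ℕ} (Q : Matrix (Fin n) (Fin n) ℝ) : ℝ :=
  sSup (spectrum ℝ Q) / sInf (spectrum ℝ Q \ {0})

/-- `t` is a minimizer of `f` along coordinate `i`, the other coordinates of `x` being frozen. -/
def IsCoordArgmin {n : ℕ} (f : (Fin n → ℝ) → ℝ) (i : Fin n) (x : Fin n → ℝ) (t : ℝ) : Prop :=
  ∀ s : ℝ, f (Function.update x i t) ≤ f (Function.update x i s)

/-- One iteration of coordinate descent: replace coordinate `i` of `x` by a minimizer of `f` along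
that coordinate. (For `f = quadratic Q b` with `Q` symmetric and `Q i i > 0` there is exactly one
minimizer, see `isCoordArgmin_quadratic_iff`.) -/
noncomputable def coordStep {n : ℕ} (f : (Fin n → ℝ) → ℝ) (x : Fin n → ℝ) (i : Fin n) :
    Fin n → ℝ :=
  Function.update x i (Classical.epsilon fun t => IsCoordArgmin f i x t)

/-- Coordinate descent along a given finite list of coordinates, from left to right. -/
noncomputable def coordRun {n : ℕ} (f : (Fin n → ℝ) → ℝ) (σ : List (Fin n)) (x : Fin n → ℝ) :
    Fin n → ℝ :=
  σ.foldl (coordStep f) x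

/-- The symmetric Gauss-Seidel order `(1, 2, …, n - 1, n, n - 1, …, 1)`. -/
def sGSOrder (n : ℕ) : List (Fin n) :=
  List.finRange n ++ (List.finRange n).reverse.tail

/-- The output of sGS-CD after `k` epochs, started at `x₀`. -/
noncomputable def sGSIterate {n : ℕ} (f : (Fin n → ℝ) → ℝ) (x₀ : Fin n → ℝ) (k : ℕ) :
    Fin n → ℝ :=
  (coordRun f (sGSOrder n))^[k] x₀

/-- The expected value of `f` at the output of R-CD after `m` epochs, started at `x₀`. One epoch
consists of `n` iterations, and the coordinate of every iteration is chosen uniformly at random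
from all `n` coordinates, independently of the other iterations; hence all the `n ^ (m * n)`
sequences of coordinates are equally likely. -/
noncomputable def rcdExpectedValue {n : ℕ} (f : (Fin n → ℝ) → ℝ) (x₀ : Fin n → ℝ) (m : ℕ) : ℝ :=
  (∑ s : Fin (m * n) → Fin n, f (coordRun f (List.ofFn s) x₀)) / (n : ℝ) ^ (m * n)

/-- The exact coordinate minimizer of a convex quadratic exists and is unique. -/
theorem isCoordArgmin_quadratic_iff {n : ℕ} (Q : Matrix (Fin n) (Fin n) ℝ) (hQ : Q.IsSymm)
    (b : Fin n → ℝ) (i : Fin n) (hi : 0 < Q i i) (x : Fin n → ℝ) (t : ℝ) :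
    IsCoordArgmin (quadratic Q b) i x t ↔ t = x i + (b i - (Q *ᵥ x) i) / Q i i := by
  have hup : ∀ s : ℝ, Function.update x i s = x + Pi.single i (s - x i) := by
    intro s
    ext j
    by_cases h : j = i
    · subst h; simp
    · simp [h]
  have key : ∀ s : ℝ, quadratic Q b (Function.update x i s) = quadratic Q b x
      + (2 * (s - x i) * ((Q *ᵥ x) i - b i) + Q i i * (s - x i) ^ 2) := by
    intro s
    have h1 : x ⬝ᵥ (Q *ᵥ Pi.single i (s - x i)) = (s - x i) * (Q *ᵥ x) i := by
      rw [Matrix.dotProduct_mulVec, dotProduct_single, ← Matrix.mulVec_transpose, hQ.eq, mul_comm]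
    rw [hup, quadratic, quadratic, Matrix.mulVec_add, dotProduct_add, dotProduct_add,
      add_dotProduct, add_dotProduct, h1, single_dotProduct, single_dotProduct, dotProduct_single]
    have h2 : (Q *ᵥ Pi.single i (s - x i)) i = Q i i * (s - x i) := by
      simp [Matrix.mulVec, dotProduct_single]
    rw [h2]
    ring
  set u := x i + (b i - (Q *ᵥ x) i) / Q i i with hu
  have hne : Q i i ≠ 0 := hi.ne'
  have key2 : ∀ s : ℝ, quadratic Q b (Function.update x i s)
      = quadratic Q b (Function.update x i u) + Q i i * (s - u) ^ 2 := by
    intro s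
    have hb : b i - (Q *ᵥ x) i = Q i i * (u - x i) := by
      rw [hu]; field_simp; ring
    rw [key s, key u]
    linear_combination (-2 * (s - u)) * hb
  constructor
  · intro h
    have h1 := h u
    rw [key2 t] at h1
    have h2 : (t - u) ^ 2 ≤ 0 := by
      by_contra hc
      have := mul_pos hi (not_le.mp hc)
      linarith
    have h3 : t - u = 0 := by
      have := le_antisymm h2 (sq_nonneg _)
      exact pow_eq_zero_iff (two_ne_zero) |>.mp this
    linarith
  · intro h s
    rw [h, key2 s]
    have := mul_nonneg hi.le (sq_nonneg (s - u))
    linarith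

end CoordDescent

/-!
Let `z` be the minimizer, so that `b = Q z`, and let `v = x - z` be the error. Then
`f x - f z = ⟨v, v⟩` for the inner product `⟨u, w⟩ = u ⬝ᵥ (Q *ᵥ w)`, and an exact coordinate step
is the orthogonal projection `errorStep`, which lowers `⟨v, v⟩` by `(Q v) i ^ 2`. Only the error
`x₀ - z` matters, so choosing `b` amounts to choosing the initial error.

*Lower bound.* If `T` is the forward sweep, the symmetric sweep is `M = T⋆ T`
(`dotProduct_foldl_sGSOrder`), since the repeated step at the last coordinate is idempotent. As `M`
is self-adjoint and positive semidefinite, the ratios `⟨v, M^(j+1) v⟩ / ⟨v, M^j v⟩` do not decrease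
with `j`; hence `⟨T v, T v⟩ ≥ ρ ⟨v, v⟩` with `ρ ≥ 0` implies `⟨M^k v, M^k v⟩ ≥ ρ^(2k) ⟨v, v⟩` for
all `k` (`rayleigh_sGS_iterate`). So it suffices to exhibit one vector with a large Rayleigh
quotient. As `c → 1`, a forward sweep on a suitable nearly mean-zero vector loses about
`(1 - c)² ∑ (v (i+1) - v i)²` out of about `(1 - c) ∑ (v i)²`, so the Rayleigh quotient is governed
by that of the Laplacian of a path. Instead of its cosine eigenvector, `slowError` is an arithmetic
progression: with the appropriate shift, every step of the forward sweep lowers its coordinate by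
exactly `(1 - c) / c` (`foldl_take_slowError`). The resulting ratio, about `12 (1 - c) / n²`, is
below `4π² / (nκ)`, which is about `4π² (1 - c) / n²` (`rayleigh_slowError`).

*Comparison.* A uniformly random step contracts `⟨v, v⟩` on average by `1 - (1 - c) / n`
(`sum_energy_foldl_errorStep_le`), so about `log (1 / ε) / (1 - c)` epochs of the randomized method
suffice for every initial error, while by the lower bound the symmetric sweep needs at least a
constant times `n² log (1 / ε) / (1 - c)` epochs.
-/

namespace CoordDescent

/-! ### Coordinate descent in terms of the error vector -/

/-- The effect of one exact coordinate minimization on the error `v = x - x⋆`, for a quadratic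
whose matrix `Q` has unit diagonal: the coordinate `i` is decreased by `(Q v) i`. -/
def errorStep {n : ℕ} (Q : Matrix (Fin n) (Fin n) ℝ) (v : Fin n → ℝ) (i : Fin n) : Fin n → ℝ :=
  v - Pi.single i ((Q *ᵥ v) i)

section Error

variable {n : ℕ} {Q : Matrix (Fin n) (Fin n) ℝ}

theorem dotProduct_mulVec_comm (hQ : Q.IsSymm) (u w : Fin n → ℝ) :
    u ⬝ᵥ (Q *ᵥ w) = w ⬝ᵥ (Q *ᵥ u) := by
  rw [Matrix.dotProduct_mulVec, ← Matrix.mulVec_transpose, hQ.eq, dotProduct_comm]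

theorem quadratic_sub_quadratic (hQ : Q.IsSymm) (z x : Fin n → ℝ) :
    quadratic Q (Q *ᵥ z) x - quadratic Q (Q *ᵥ z) z = (x - z) ⬝ᵥ (Q *ᵥ (x - z)) := by
  simp only [quadratic, Matrix.mulVec_sub, dotProduct_sub, sub_dotProduct]
  rw [dotProduct_comm (Q *ᵥ z) x, dotProduct_comm (Q *ᵥ z) z, dotProduct_mulVec_comm hQ z x]
  ring

theorem coordStep_sub (hQ : Q.IsSymm) (hd : ∀ i, Q i i = 1) (z x : Fin n → ℝ) (i : Fin n) :
    coordStep (quadratic Q (Q *ᵥ z)) x i - z = errorStep Q (x - z) i := by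
  have hi : 0 < Q i i := by rw [hd]; exact one_pos
  have h := Classical.epsilon_spec (p := fun t => IsCoordArgmin (quadratic Q (Q *ᵥ z)) i x t)
    ⟨_, (isCoordArgmin_quadratic_iff Q hQ (Q *ᵥ z) i hi x _).2 rfl⟩
  have h2 := (isCoordArgmin_quadratic_iff Q hQ (Q *ᵥ z) i hi x _).1 h
  rw [coordStep, h2, hd]
  ext j
  by_cases hj : j = i
  · subst hj
    simp [errorStep, Matrix.mulVec_sub]
    ring
  · simp [errorStep, hj]

theorem coordRun_sub (hQ : Q.IsSymm) (hd : ∀ i, Q i i = 1) (z : Fin n → ℝ) (σ : List (Fin n))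
    (x : Fin n → ℝ) :
    coordRun (quadratic Q (Q *ᵥ z)) σ x - z = σ.foldl (errorStep Q) (x - z) := by
  induction σ generalizing x with
  | nil => rfl
  | cons i σ ih =>
    have h := ih (coordStep (quadratic Q (Q *ᵥ z)) x i)
    rw [coordStep_sub hQ hd] at h
    exact h

theorem sGSIterate_sub (hQ : Q.IsSymm) (hd : ∀ i, Q i i = 1) (z x : Fin n → ℝ) (k : ℕ) :
    sGSIterate (quadratic Q (Q *ᵥ z)) x k - z
      = (fun v => (sGSOrder n).foldl (errorStep Q) v)^[k] (x - z) := by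
  induction k with
  | zero => rfl
  | succ k ih =>
    rw [Function.iterate_succ_apply', ← ih, ← coordRun_sub hQ hd, sGSIterate, sGSIterate,
      Function.iterate_succ_apply']

/-- For `Q` with unit diagonal, `errorStep Q · i` is the `Q`-orthogonal projection along the `i`-th
unit vector; its self-adjointness for `⟨u, w⟩ = u ⬝ᵥ (Q *ᵥ w)` only needs `Q` symmetric. -/
theorem errorStep_dotProduct (hQ : Q.IsSymm) (u w : Fin n → ℝ) (i : Fin n) :
    errorStep Q u i ⬝ᵥ (Q *ᵥ w) = u ⬝ᵥ (Q *ᵥ errorStep Q w i) := by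
  rw [dotProduct_mulVec_comm hQ u]
  simp only [errorStep, sub_dotProduct, single_dotProduct]
  rw [dotProduct_mulVec_comm hQ u]
  ring

theorem mulVec_errorStep_self (hd : ∀ i, Q i i = 1) (v : Fin n → ℝ) (i : Fin n) :
    (Q *ᵥ errorStep Q v i) i = 0 := by
  simp [errorStep, Matrix.mulVec_sub, Matrix.mulVec_single, hd]

theorem errorStep_errorStep (hd : ∀ i, Q i i = 1) (v : Fin n → ℝ) (i : Fin n) :
    errorStep Q (errorStep Q v i) i = errorStep Q v i := by
  rw [errorStep, mulVec_errorStep_self hd]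
  simp

theorem energy_errorStep (hQ : Q.IsSymm) (hd : ∀ i, Q i i = 1) (v : Fin n → ℝ) (i : Fin n) :
    errorStep Q v i ⬝ᵥ (Q *ᵥ errorStep Q v i) = v ⬝ᵥ (Q *ᵥ v) - (Q *ᵥ v) i ^ 2 := by
  rw [← errorStep_dotProduct hQ, errorStep_errorStep hd]
  simp only [errorStep, sub_dotProduct, single_dotProduct]
  ring

theorem foldl_errorStep_dotProduct (hQ : Q.IsSymm) (σ : List (Fin n)) (u w : Fin n → ℝ) :
    σ.foldl (errorStep Q) u ⬝ᵥ (Q *ᵥ w)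
      = u ⬝ᵥ (Q *ᵥ σ.reverse.foldl (errorStep Q) w) := by
  induction σ generalizing u with
  | nil => rfl
  | cons i σ ih =>
    rw [List.foldl_cons, ih, errorStep_dotProduct hQ]
    simp [List.foldl_append]

/-- Since an exact coordinate step is idempotent, the symmetric sweep is a forward sweep followed
by the full backward sweep. -/
theorem foldl_sGSOrder (hd : ∀ i, Q i i = 1) (v : Fin n → ℝ) :
    (sGSOrder n).foldl (errorStep Q) v
      = (List.finRange n).reverse.foldl (errorStep Q)
          ((List.finRange n).foldl (errorStep Q) v) := by
  rw [sGSOrder, List.foldl_append]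
  generalize List.finRange n = l
  rcases h : l.reverse with _ | ⟨a, t⟩
  · rfl
  · have hl : l = t.reverse ++ [a] := by
      rw [← List.reverse_reverse l, h, List.reverse_cons]
    simp [hl, List.foldl_append, errorStep_errorStep hd]

/-- With `T` the forward sweep, the symmetric sweep is `T⋆ T` for the `Q`-inner product. -/
theorem dotProduct_foldl_sGSOrder (hQ : Q.IsSymm) (hd : ∀ i, Q i i = 1) (u w : Fin n → ℝ) :
    u ⬝ᵥ (Q *ᵥ (sGSOrder n).foldl (errorStep Q) w)
      = (List.finRange n).foldl (errorStep Q) u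
          ⬝ᵥ (Q *ᵥ (List.finRange n).foldl (errorStep Q) w) := by
  rw [foldl_sGSOrder hd, foldl_errorStep_dotProduct hQ]

theorem errorStep_sub_smul (u w : Fin n → ℝ) (r : ℝ) (i : Fin n) :
    errorStep Q (u - r • w) i = errorStep Q u i - r • errorStep Q w i := by
  ext j
  by_cases hj : j = i
  · subst hj
    simp [errorStep, Matrix.mulVec_sub, Matrix.mulVec_smul]
    ring
  · simp [errorStep, hj]

theorem foldl_errorStep_sub_smul (σ : List (Fin n)) (u w : Fin n → ℝ) (r : ℝ) :
    σ.foldl (errorStep Q) (u - r • w)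
      = σ.foldl (errorStep Q) u - r • σ.foldl (errorStep Q) w := by
  induction σ generalizing u w with
  | nil => rfl
  | cons i σ ih => simp only [List.foldl_cons, errorStep_sub_smul, ih]

/-- A Rayleigh quotient bound `⟨v, M v⟩ ≥ ρ ⟨v, v⟩` for the symmetric sweep `M = T⋆ T` yields
`⟨M v, M v⟩ ≥ ρ² ⟨v, v⟩` and is inherited by `M v`, so it can be iterated. -/
theorem rayleigh_sGS_step (hQ : Q.IsSymm) (hd : ∀ i, Q i i = 1)
    (hpos : ∀ v : Fin n → ℝ, 0 ≤ v ⬝ᵥ (Q *ᵥ v)) {ρ : ℝ} (hρ : 0 ≤ ρ) (v : Fin n → ℝ)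
    (h : ρ * (v ⬝ᵥ (Q *ᵥ v)) ≤ v ⬝ᵥ (Q *ᵥ (sGSOrder n).foldl (errorStep Q) v)) :
    ρ ^ 2 * (v ⬝ᵥ (Q *ᵥ v)) ≤ (sGSOrder n).foldl (errorStep Q) v
        ⬝ᵥ (Q *ᵥ (sGSOrder n).foldl (errorStep Q) v) ∧
      ρ * ((sGSOrder n).foldl (errorStep Q) v ⬝ᵥ (Q *ᵥ (sGSOrder n).foldl (errorStep Q) v))
        ≤ (sGSOrder n).foldl (errorStep Q) v
          ⬝ᵥ (Q *ᵥ (sGSOrder n).foldl (errorStep Q) ((sGSOrder n).foldl (errorStep Q) v)) := by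
  set w := (sGSOrder n).foldl (errorStep Q) v with hw
  -- `w - ρ v` has nonnegative norm, and `M` is positive semidefinite at `w - ρ v`
  have h1 := hpos (w - ρ • v)
  have h2 : 0 ≤ (w - ρ • v) ⬝ᵥ (Q *ᵥ (sGSOrder n).foldl (errorStep Q) (w - ρ • v)) := by
    rw [dotProduct_foldl_sGSOrder hQ hd]
    exact hpos _
  have h3 : v ⬝ᵥ (Q *ᵥ (sGSOrder n).foldl (errorStep Q) w) = w ⬝ᵥ (Q *ᵥ w) := by
    rw [dotProduct_foldl_sGSOrder hQ hd, dotProduct_mulVec_comm hQ,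
      ← dotProduct_foldl_sGSOrder hQ hd]
  rw [foldl_errorStep_sub_smul, ← hw] at h2
  simp only [Matrix.mulVec_sub, Matrix.mulVec_smul, dotProduct_sub, sub_dotProduct,
    dotProduct_smul, smul_dotProduct, smul_eq_mul] at h1 h2
  rw [h3] at h2
  rw [dotProduct_mulVec_comm hQ w v] at h1
  have h4 := mul_le_mul_of_nonneg_left h hρ
  have h5 : ρ * (v ⬝ᵥ (Q *ᵥ w)) ≤ w ⬝ᵥ (Q *ᵥ w) := by nlinarith
  have h6 := mul_le_mul_of_nonneg_left h5 hρ
  constructor <;> nlinarith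

theorem rayleigh_sGS_iterate (hQ : Q.IsSymm) (hd : ∀ i, Q i i = 1)
    (hpos : ∀ v : Fin n → ℝ, 0 ≤ v ⬝ᵥ (Q *ᵥ v)) {ρ : ℝ} (hρ : 0 ≤ ρ) (k : ℕ) (v : Fin n → ℝ)
    (h : ρ * (v ⬝ᵥ (Q *ᵥ v)) ≤ (List.finRange n).foldl (errorStep Q) v
      ⬝ᵥ (Q *ᵥ (List.finRange n).foldl (errorStep Q) v)) :
    ρ ^ (2 * k) * (v ⬝ᵥ (Q *ᵥ v)) ≤ (fun v => (sGSOrder n).foldl (errorStep Q) v)^[k] v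
      ⬝ᵥ (Q *ᵥ (fun v => (sGSOrder n).foldl (errorStep Q) v)^[k] v) := by
  induction k generalizing v with
  | zero => simp
  | succ k ih =>
    rw [← dotProduct_foldl_sGSOrder hQ hd] at h
    obtain ⟨h1, h2⟩ := rayleigh_sGS_step hQ hd hpos hρ v h
    refine le_trans ?_ (ih _ (h2.trans_eq (dotProduct_foldl_sGSOrder hQ hd _ _)))
    calc ρ ^ (2 * (k + 1)) * (v ⬝ᵥ (Q *ᵥ v))
        = ρ ^ (2 * k) * (ρ ^ 2 * (v ⬝ᵥ (Q *ᵥ v))) := by ring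
      _ ≤ _ := mul_le_mul_of_nonneg_left h1 (pow_nonneg hρ _)

/-- If `‖Q v‖² ≥ μ ⟨v, Q v⟩`, a uniformly random coordinate step contracts the energy by the factor
`1 - μ / n` on average. -/
theorem sum_energy_foldl_errorStep_le (hQ : Q.IsSymm) (hd : ∀ i, Q i i = 1) {μ : ℝ}
    (hμn : μ ≤ n) (hμ : ∀ v : Fin n → ℝ, μ * (v ⬝ᵥ (Q *ᵥ v)) ≤ ∑ i, (Q *ᵥ v) i ^ 2) (N : ℕ)
    (v : Fin n → ℝ) :
    ∑ s : Fin N → Fin n, (List.ofFn s).foldl (errorStep Q) v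
        ⬝ᵥ (Q *ᵥ (List.ofFn s).foldl (errorStep Q) v)
      ≤ (n - μ) ^ N * (v ⬝ᵥ (Q *ᵥ v)) := by
  induction N generalizing v with
  | zero => simp
  | succ N ih =>
    rw [← (Fin.consEquiv fun _ => Fin n).sum_comp, Fintype.sum_prod_type]
    have hs : ∀ (i : Fin n) (s : Fin N → Fin n),
        List.ofFn ((Fin.consEquiv fun _ => Fin n) (i, s)) = i :: List.ofFn s :=
      fun i s => List.ofFn_cons i s
    simp only [hs, List.foldl_cons]
    calc _ ≤ ∑ i, (n - μ) ^ N * (errorStep Q v i ⬝ᵥ (Q *ᵥ errorStep Q v i)) :=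
          Finset.sum_le_sum fun i _ => ih _
      _ = (n - μ) ^ N * (n * (v ⬝ᵥ (Q *ᵥ v)) - ∑ i, (Q *ᵥ v) i ^ 2) := by
          simp [← Finset.mul_sum, energy_errorStep hQ hd, Finset.sum_sub_distrib]
      _ ≤ (n - μ) ^ N * (n * (v ⬝ᵥ (Q *ᵥ v)) - μ * (v ⬝ᵥ (Q *ᵥ v))) :=
          mul_le_mul_of_nonneg_left (sub_le_sub_left (hμ v) _) (pow_nonneg (sub_nonneg.2 hμn) _)
      _ = _ := by ring

theorem rcdExpectedValue_sub_le (hQ : Q.IsSymm) (hd : ∀ i, Q i i = 1) (hn : 0 < n) {μ : ℝ}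
    (hμn : μ ≤ n) (hμ : ∀ v : Fin n → ℝ, μ * (v ⬝ᵥ (Q *ᵥ v)) ≤ ∑ i, (Q *ᵥ v) i ^ 2)
    (z x : Fin n → ℝ) (m : ℕ) :
    rcdExpectedValue (quadratic Q (Q *ᵥ z)) x m - quadratic Q (Q *ᵥ z) z
      ≤ (1 - μ / n) ^ (m * n) * ((x - z) ⬝ᵥ (Q *ᵥ (x - z))) := by
  have hn' : (0 : ℝ) < n := by exact_mod_cast hn
  have hN : (0 : ℝ) < (n : ℝ) ^ (m * n) := pow_pos hn' _
  have h := sum_energy_foldl_errorStep_le hQ hd hμn hμ (m * n) (x - z)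
  simp only [← coordRun_sub hQ hd, ← quadratic_sub_quadratic hQ, Finset.sum_sub_distrib] at h
  simp only [Finset.sum_const, Finset.card_univ, Fintype.card_fun, Fintype.card_fin,
    nsmul_eq_mul, Nat.cast_pow] at h
  have h1 : 1 - μ / n = (n - μ) / n := by field_simp
  rw [h1, div_pow, rcdExpectedValue, ← quadratic_sub_quadratic hQ, div_mul_eq_mul_div,
    le_div_iff₀ hN, sub_mul, div_mul_cancel₀ _ hN.ne']
  linarith

end Error

/-! ### The matrix with constant off-diagonal entries -/

section UnitDiag

variable {n : ℕ} {c : ℝ}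

theorem unitDiag_apply_self (i : Fin n) : unitDiag n c i i = 1 := by simp [unitDiag]

theorem unitDiag_isSymm : (unitDiag n c).IsSymm := by
  ext i j
  simp [unitDiag, eq_comm]

theorem unitDiag_mulVec (v : Fin n → ℝ) (i : Fin n) :
    (unitDiag n c *ᵥ v) i = (1 - c) * v i + c * ∑ j, v j := by
  have h : ∀ j, unitDiag n c i j * v j = (if i = j then (1 - c) * v j else 0) + c * v j := by
    intro j
    by_cases hj : i = j
    · simp [unitDiag, hj]
      ring
    · simp [unitDiag, hj]
  simp only [Matrix.mulVec, dotProduct, h, Finset.sum_add_distrib, Finset.mul_sum]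
  simp

theorem energy_unitDiag (v : Fin n → ℝ) :
    v ⬝ᵥ (unitDiag n c *ᵥ v) = (1 - c) * ∑ i, v i ^ 2 + c * (∑ i, v i) ^ 2 := by
  simp only [dotProduct, unitDiag_mulVec, mul_add, Finset.sum_add_distrib]
  rw [← Finset.sum_mul, Finset.mul_sum _ (fun i => v i ^ 2)]
  congr 1
  · exact Finset.sum_congr rfl fun i _ => by ring
  · ring

theorem unitDiag_posDef (hc0 : 0 < c) (hc1 : c < 1) : (unitDiag n c).PosDef := by
  refine Matrix.PosDef.of_dotProduct_mulVec_pos ?_ fun v hv => ?_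
  · rw [Matrix.IsHermitian, Matrix.conjTranspose_eq_transpose_of_trivial, unitDiag_isSymm.eq]
  · rw [star_trivial, energy_unitDiag]
    obtain ⟨i, hi⟩ := Function.ne_iff.1 hv
    have h1 : 0 < ∑ i, v i ^ 2 :=
      Finset.sum_pos' (fun i _ => sq_nonneg _) ⟨i, Finset.mem_univ _, by
        have : v i ≠ 0 := hi
        positivity⟩
    have h2 : 0 < 1 - c := sub_pos.2 hc1
    positivity

/-- The smallest eigenvalue `1 - c` as a lower bound, in the gradient-dominance form used for the
randomized method. -/
theorem energy_le_sum_mulVec_sq (hc0 : 0 ≤ c) (hc1 : c ≤ 1) (v : Fin n → ℝ) :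
    (1 - c) * (v ⬝ᵥ (unitDiag n c *ᵥ v)) ≤ ∑ i, (unitDiag n c *ᵥ v) i ^ 2 := by
  have h : ∑ i, (unitDiag n c *ᵥ v) i ^ 2
      = (1 - c) * (v ⬝ᵥ (unitDiag n c *ᵥ v))
        + (c * (1 - c) + n * c ^ 2) * (∑ i, v i) ^ 2 := by
    rw [energy_unitDiag]
    simp only [unitDiag_mulVec, add_sq, mul_pow, Finset.sum_add_distrib, ← Finset.mul_sum,
      ← Finset.sum_mul, Finset.sum_const, Finset.card_univ, Fintype.card_fin, nsmul_eq_mul]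
    ring
  have h2 : 0 ≤ 1 - c := sub_nonneg.2 hc1
  rw [h]
  exact le_add_of_nonneg_right (by positivity)

theorem spectrum_unitDiag (hn : 2 ≤ n) :
    spectrum ℝ (unitDiag n c) = {1 - c, 1 - c + c * n} := by
  ext μ
  rw [← Matrix.spectrum_toLin', ← Module.End.hasEigenvalue_iff_mem_spectrum]
  simp only [Set.mem_insert_iff, Set.mem_singleton_iff]
  constructor
  · intro h
    obtain ⟨v, hv⟩ := h.exists_hasEigenvector
    obtain ⟨h1, h2⟩ := Module.End.hasEigenvector_iff.1 hv
    rw [Module.End.mem_eigenspace_iff, Matrix.toLin'_apply] at h1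
    by_contra! hμ
    obtain ⟨hμ1, hμ2⟩ := hμ
    have h3 : ∀ i, (μ - (1 - c)) * v i = c * ∑ j, v j := by
      intro i
      have h4 := congrFun h1 i
      rw [unitDiag_mulVec, Pi.smul_apply, smul_eq_mul] at h4
      linarith
    have h5 : (μ - (1 - c)) * ∑ i, v i = c * n * ∑ j, v j := by
      rw [Finset.mul_sum, Finset.sum_congr rfl fun i _ => h3 i]
      simp
      ring
    have h6 : ∑ i, v i = 0 := by
      have : (μ - (1 - c + c * n)) * ∑ i, v i = 0 := by linarith
      exact (mul_eq_zero.1 this).resolve_left (sub_ne_zero.2 hμ2)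
    refine h2 (funext fun i => ?_)
    have h7 := h3 i
    rw [h6, mul_zero] at h7
    exact (mul_eq_zero.1 h7).resolve_left (sub_ne_zero.2 hμ1)
  · rintro (rfl | rfl)
    · let i₀ : Fin n := ⟨0, by omega⟩
      let i₁ : Fin n := ⟨1, by omega⟩
      have hne : i₀ ≠ i₁ := by simp [i₀, i₁]
      refine Module.End.hasEigenvalue_of_hasEigenvector
        (x := Pi.single i₀ (1 : ℝ) - Pi.single i₁ 1) (Module.End.hasEigenvector_iff.2 ⟨?_, ?_⟩)
      · rw [Module.End.mem_eigenspace_iff, Matrix.toLin'_apply]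
        ext i
        rw [unitDiag_mulVec]
        simp [Finset.sum_sub_distrib]
      · intro h
        have := congrFun h i₀
        simp [hne] at this
    · refine Module.End.hasEigenvalue_of_hasEigenvector (x := fun _ => (1 : ℝ))
        (Module.End.hasEigenvector_iff.2 ⟨?_, ?_⟩)
      · rw [Module.End.mem_eigenspace_iff, Matrix.toLin'_apply]
        ext i
        rw [unitDiag_mulVec]
        simp
      · intro h
        have := congrFun h ⟨0, by omega⟩
        simp at this

theorem condNumber_unitDiag (hn : 2 ≤ n) (hc0 : 0 < c) (hc1 : c < 1) :
    condNumber (unitDiag n c) = (1 - c + c * n) / (1 - c) := by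
  have hη : 0 < 1 - c := sub_pos.2 hc1
  have h1 : 1 - c ≤ 1 - c + c * n := le_add_of_nonneg_right (by positivity)
  have h2 : ({1 - c, 1 - c + c * n} : Set ℝ) \ {0} = {1 - c, 1 - c + c * n} := by
    rw [Set.sdiff_singleton_eq_self]
    rintro (h | h)
    · exact hη.ne h
    · exact (hη.trans_le h1).ne h
  rw [condNumber, spectrum_unitDiag hn, h2, csSup_pair, csInf_pair, max_eq_right h1,
    min_eq_left h1]

/-! ### A slow starting point for the forward sweep -/

/-- The error `v i = i + a`, with the shift `a` chosen such that the forward sweep decreases every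
coordinate by the same amount `(1 - c) / c`. -/
noncomputable def slowError (n : ℕ) (c : ℝ) (i : Fin n) : ℝ :=
  i + ((1 - c) / c - c * (n * (n - 1) / 2)) / (1 - c + c * n)

theorem sum_add_const (n : ℕ) (a : ℝ) :
    ∑ i : Fin n, ((i : ℝ) + a) = n * a + n * (n - 1) / 2 := by
  rw [Fin.sum_univ_eq_sum_range (fun i : ℕ => (i : ℝ) + a)]
  induction n with
  | zero => simp
  | succ n ih =>
    rw [Finset.sum_range_succ, ih]
    push_cast
    ring

theorem sum_add_const_sq (n : ℕ) (a : ℝ) :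
    ∑ i : Fin n, ((i : ℝ) + a) ^ 2
      = n * (a + (n - 1) / 2) ^ 2 + n * ((n : ℝ) ^ 2 - 1) / 12 := by
  rw [Fin.sum_univ_eq_sum_range (fun i : ℕ => ((i : ℝ) + a) ^ 2)]
  induction n with
  | zero => simp
  | succ n ih =>
    rw [Finset.sum_range_succ, ih]
    push_cast
    ring

theorem energy_slowError_ge (hc0 : 0 < c) (hc1 : c < 1) :
    (1 - c) * (n * ((n : ℝ) ^ 2 - 1) / 12)
      ≤ slowError n c ⬝ᵥ (unitDiag n c *ᵥ slowError n c) := by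
  have hη : 0 < 1 - c := sub_pos.2 hc1
  rw [energy_unitDiag]
  refine le_trans (mul_le_mul_of_nonneg_left ?_ hη.le) (le_add_of_nonneg_right (by positivity))
  simp only [slowError]
  rw [sum_add_const_sq]
  exact le_add_of_nonneg_left (by positivity)

/-- After `k` steps of the forward sweep, the first `k` coordinates of `slowError` have decreased by
`(1 - c) / c`, and each step has decreased the energy by the square of that number. -/
theorem foldl_take_slowError (hc0 : 0 < c) (hc1 : c < 1) (k : ℕ) (hk : k ≤ n) :
    ((List.finRange n).take k).foldl (errorStep (unitDiag n c)) (slowError n c)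
        = (fun i => slowError n c i - if (i : ℕ) < k then (1 - c) / c else 0) ∧
      ((List.finRange n).take k).foldl (errorStep (unitDiag n c)) (slowError n c) ⬝ᵥ
        (unitDiag n c *ᵥ
          ((List.finRange n).take k).foldl (errorStep (unitDiag n c)) (slowError n c))
        = slowError n c ⬝ᵥ (unitDiag n c *ᵥ slowError n c) - k * ((1 - c) / c) ^ 2 := by
  induction k with
  | zero => simp
  | succ k ih =>
    obtain ⟨h1, h2⟩ := ih (by omega)
    have htake : (List.finRange n).take (k + 1) = (List.finRange n).take k ++ [⟨k, hk⟩] := by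
      rw [List.take_succ_eq_append_getElem (by simpa using hk)]
      simp
    set w := ((List.finRange n).take k).foldl (errorStep (unitDiag n c)) (slowError n c) with hw
    have hsum : ∑ i : Fin n, (if (i : ℕ) < k then (1 - c) / c else 0) = k * ((1 - c) / c) := by
      rw [Fin.sum_univ_eq_sum_range (fun i : ℕ => if i < k then (1 - c) / c else 0),
        ← Finset.sum_filter]
      have : (Finset.range n).filter (· < k) = Finset.range k := by
        ext i
        simp only [Finset.mem_filter, Finset.mem_range]
        omega
      simp [this]
    have hden : 1 - c + c * n ≠ 0 := by
      have : 0 < 1 - c := sub_pos.2 hc1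
      positivity
    have hgrad : (unitDiag n c *ᵥ w) ⟨k, hk⟩ = (1 - c) / c := by
      rw [unitDiag_mulVec, h1, Finset.sum_sub_distrib, hsum]
      simp only [slowError, sum_add_const, lt_irrefl, if_false]
      field_simp
      ring
    rw [htake, List.foldl_append, ← hw, List.foldl_cons, List.foldl_nil]
    constructor
    · ext i
      rw [errorStep, hgrad, h1]
      rcases lt_trichotomy (i : ℕ) k with hi | hi | hi
      · have : i ≠ ⟨k, hk⟩ := fun h => by simp [h] at hi
        simp [this, hi, hi.trans (Nat.lt_succ_self k)]
      · have : i = ⟨k, hk⟩ := Fin.ext hi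
        subst this
        simp
      · have h3 : i ≠ ⟨k, hk⟩ := fun h => by simp [h] at hi
        have h4 : ¬ (i : ℕ) < k := by omega
        have h5 : ¬ (i : ℕ) < k + 1 := by omega
        simp [h3, h4, h5]
    · rw [energy_errorStep unitDiag_isSymm unitDiag_apply_self, h2, hgrad]
      push_cast
      ring

theorem energy_foldl_slowError (hc0 : 0 < c) (hc1 : c < 1) :
    (List.finRange n).foldl (errorStep (unitDiag n c)) (slowError n c) ⬝ᵥ
        (unitDiag n c *ᵥ (List.finRange n).foldl (errorStep (unitDiag n c)) (slowError n c))
      = slowError n c ⬝ᵥ (unitDiag n c *ᵥ slowError n c) - n * ((1 - c) / c) ^ 2 := by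
  have h := (foldl_take_slowError (n := n) hc0 hc1 n le_rfl).2
  rwa [List.take_of_length_le (by simp)] at h

/-! ### Comparison of the rates -/

/-- The hypothesis `49 / 50 < c` leaves room for the crude bounds `3 < π < 4`. -/
theorem rate_bounds (hn : 2 ≤ n) (hc : 49 / 50 < c) (hc1 : c < 1) :
    36 * (1 - c) / (n : ℝ) ^ 2 ≤ 4 * Real.pi ^ 2 / (n * condNumber (unitDiag n c)) ∧
      4 * Real.pi ^ 2 / (n * condNumber (unitDiag n c)) ≤ 80 * (1 - c) / (n : ℝ) ^ 2 := by
  have hc0 : 0 < c := by linarith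
  have hη : 0 < 1 - c := sub_pos.2 hc1
  have hn' : (2 : ℝ) ≤ n := by exact_mod_cast hn
  have hn0 : (0 : ℝ) < n := by linarith
  have hπ3 := Real.pi_gt_three
  have hπ4 := Real.pi_le_four
  have hd : 0 < 1 - c + c * n := by positivity
  rw [condNumber_unitDiag hn hc0 hc1]
  have h : 4 * Real.pi ^ 2 / (n * ((1 - c + c * n) / (1 - c)))
      = 4 * Real.pi ^ 2 * (1 - c) / (n * (1 - c + c * n)) := by
    field_simp
  have h1 : 36 ≤ 4 * Real.pi ^ 2 := by nlinarith
  have h2 : 4 * Real.pi ^ 2 ≤ 64 := by nlinarith [Real.pi_pos]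
  have h3 : 1 - c + c * n ≤ n := by nlinarith
  rw [h]
  constructor
  · rw [sq]
    gcongr
  · rw [div_le_div_iff₀ (by positivity) (by positivity)]
    have h4 : 4 / 5 * (n : ℝ) ≤ 1 - c + c * n := by nlinarith
    calc 4 * Real.pi ^ 2 * (1 - c) * (n : ℝ) ^ 2
        ≤ 64 * (1 - c) * (n : ℝ) ^ 2 := by gcongr
      _ = 80 * (1 - c) * (n * (4 / 5 * n)) := by ring
      _ ≤ 80 * (1 - c) * (n * (1 - c + c * n)) := by gcongr

/-- The Rayleigh quotient of the symmetric sweep at `slowError` is at least `1 - 4π² / (nκ)`. -/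
theorem rayleigh_slowError (hn : 2 ≤ n) (hc : 49 / 50 < c) (hc1 : c < 1) :
    (1 - 4 * Real.pi ^ 2 / (n * condNumber (unitDiag n c)))
        * (slowError n c ⬝ᵥ (unitDiag n c *ᵥ slowError n c))
      ≤ (List.finRange n).foldl (errorStep (unitDiag n c)) (slowError n c) ⬝ᵥ
        (unitDiag n c *ᵥ
          (List.finRange n).foldl (errorStep (unitDiag n c)) (slowError n c)) := by
  have hc0 : 0 < c := by linarith
  have hη : 0 < 1 - c := sub_pos.2 hc1
  have hn' : (2 : ℝ) ≤ n := by exact_mod_cast hn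
  have hn0 : (0 : ℝ) < n := by linarith
  have hn1 : 0 ≤ (n : ℝ) ^ 2 - 1 := by nlinarith
  have hE := energy_slowError_ge (n := n) hc0 hc1
  have hx := (rate_bounds hn hc hc1).1
  rw [energy_foldl_slowError hc0 hc1, sub_mul, one_mul]
  refine sub_le_sub_left ?_ _
  refine le_trans ?_ (mul_le_mul hx hE (by positivity) (le_trans (by positivity) hx))
  have h1 : 36 * (1 - c) / (n : ℝ) ^ 2 * ((1 - c) * (n * ((n : ℝ) ^ 2 - 1) / 12))
      = n * (1 - c) ^ 2 * (3 * ((n : ℝ) ^ 2 - 1) / (n : ℝ) ^ 2) := by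
    field_simp
    ring
  have h2 : n * ((1 - c) / c) ^ 2 = n * (1 - c) ^ 2 * (1 / c ^ 2) := by
    field_simp
  rw [h1, h2]
  refine mul_le_mul_of_nonneg_left ?_ (by positivity)
  rw [div_le_div_iff₀ (by positivity) (by positivity)]
  have h3 : 2 / 3 ≤ c ^ 2 := by nlinarith
  nlinarith

/-- A method with rate `(1 - x)²` per epoch needs at least `log (1 / ε) / (4 x)` epochs to reach
relative accuracy `ε`. -/
theorem log_inv_le_of_pow_le {x ε : ℝ} {k : ℕ} (hx0 : 0 ≤ x) (hx : x ≤ 1 / 2) (hε : 0 < ε)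
    (h : (1 - x) ^ (2 * k) ≤ ε) : Real.log ε⁻¹ ≤ 4 * x * k := by
  have h1 : Real.exp (-(2 * x)) ≤ 1 - x := by
    rw [Real.exp_neg, inv_le_comm₀ (Real.exp_pos _) (by linarith)]
    refine le_trans ?_ (Real.add_one_le_exp _)
    rw [inv_le_iff_one_le_mul₀ (by linarith)]
    nlinarith
  have h2 : Real.exp (-(4 * x * k)) ≤ ε := by
    refine le_trans ?_ h
    have : -(4 * x * k) = ((2 * k : ℕ) : ℝ) * -(2 * x) := by
      push_cast
      ring
    rw [this, Real.exp_nat_mul]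
    exact pow_le_pow_left₀ (Real.exp_pos _).le h1 _
  rw [Real.log_inv, neg_le, Real.le_log_iff_exp_le hε]
  exact h2

theorem one_sub_div_pow_le_exp {η : ℝ} (n m : ℕ) (hn : 0 < n) (hη : η ≤ n) :
    (1 - η / n) ^ (m * n) ≤ Real.exp (-(η * m)) := by
  have hn' : (0 : ℝ) < n := by exact_mod_cast hn
  have h0 : 0 ≤ 1 - η / n := sub_nonneg.2 ((div_le_one hn').2 hη)
  calc (1 - η / n) ^ (m * n) ≤ Real.exp (-(η / n)) ^ (m * n) :=
        pow_le_pow_left₀ h0 (Real.one_sub_le_exp_neg _) _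
    _ = Real.exp (-(η * m)) := by
        rw [← Real.exp_nat_mul]
        congr 1
        push_cast
        field_simp

end UnitDiag

end CoordDescent

theorem mainTheorem1 :
    ∃ C : ℝ, 0 < C ∧
      ∀ (n : ℕ), 2 ≤ n → ∀ (x₀ : Fin n → ℝ) (δ : ℝ), 0 < δ → δ ≤ 1 →
        ∃ c₀ : ℝ, 0 ≤ c₀ ∧ c₀ < 1 ∧ ∀ c : ℝ, c₀ < c → c < 1 →
          (CoordDescent.unitDiag n c).PosDef ∧
          ∃ (b : Fin n → ℝ) (fstar : ℝ),
            IsLeast (Set.range (CoordDescent.quadratic (CoordDescent.unitDiag n c) b)) fstar ∧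
            fstar < CoordDescent.quadratic (CoordDescent.unitDiag n c) b x₀ ∧
            -- the lower bound for sGS-CD
            (∀ k : ℕ,
              (1 - δ) *
                  (1 - 4 * Real.pi ^ 2 /
                    ((n : ℝ) * CoordDescent.condNumber (CoordDescent.unitDiag n c))) ^ (2 * k + 2) *
                  (CoordDescent.quadratic (CoordDescent.unitDiag n c) b x₀ - fstar) ≤
                CoordDescent.quadratic (CoordDescent.unitDiag n c) b
                    (CoordDescent.sGSIterate
                      (CoordDescent.quadratic (CoordDescent.unitDiag n c) b) x₀ k) - fstar) ∧
            -- whenever sGS-CD has relative error at most `ε` after `k` epochs,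
            -- R-CD has expected relative error at most `ε` after some `m ≤ k / (C n²)` epochs
            (∀ ε : ℝ, 0 < ε → ε ≤ 1 / 2 → ∀ k : ℕ,
              CoordDescent.quadratic (CoordDescent.unitDiag n c) b
                    (CoordDescent.sGSIterate
                      (CoordDescent.quadratic (CoordDescent.unitDiag n c) b) x₀ k) - fstar ≤
                  ε * (CoordDescent.quadratic (CoordDescent.unitDiag n c) b x₀ - fstar) →
              ∃ m : ℕ, C * (n : ℝ) ^ 2 * (m : ℝ) ≤ (k : ℝ) ∧
                CoordDescent.rcdExpectedValue
                    (CoordDescent.quadratic (CoordDescent.unitDiag n c) b) x₀ m - fstar ≤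
                  ε * (CoordDescent.quadratic (CoordDescent.unitDiag n c) b x₀ - fstar)) := by
  refine ⟨1 / 640, by norm_num, fun n hn x₀ δ hδ0 _ =>
    ⟨49 / 50, by norm_num, by norm_num, fun c hc hc1 => ?_⟩⟩
  have hc0 : 0 < c := by linarith
  have hη : 0 < 1 - c := sub_pos.2 hc1
  have hn' : (2 : ℝ) ≤ n := by exact_mod_cast hn
  have hn0 : 0 < n := by omega
  have hpd := CoordDescent.unitDiag_posDef (n := n) hc0 hc1
  refine ⟨hpd, ?_⟩
  have hQ : (CoordDescent.unitDiag n c).IsSymm := CoordDescent.unitDiag_isSymm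
  have hd : ∀ i, CoordDescent.unitDiag n c i i = 1 := CoordDescent.unitDiag_apply_self
  have hpos : ∀ v : Fin n → ℝ, 0 ≤ v ⬝ᵥ (CoordDescent.unitDiag n c *ᵥ v) :=
    fun v => by
      rw [CoordDescent.energy_unitDiag]
      positivity
  have hray := CoordDescent.rayleigh_slowError hn hc hc1
  obtain ⟨hxl, hxu⟩ := CoordDescent.rate_bounds hn hc hc1
  have hE0 := CoordDescent.energy_slowError_ge (n := n) hc0 hc1
  -- the minimizer `z` is placed such that the initial error `x₀ - z` is the slow one
  obtain ⟨z, hz⟩ : ∃ z, x₀ - z = CoordDescent.slowError n c :=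
    ⟨x₀ - CoordDescent.slowError n c, sub_sub_cancel _ _⟩
  set Q := CoordDescent.unitDiag n c with hQdef
  set x := 4 * Real.pi ^ 2 / ((n : ℝ) * CoordDescent.condNumber Q) with hxdef
  have hx0 : 0 ≤ x := le_trans (by positivity) hxl
  have hx1 : x ≤ 1 / 2 := by
    refine hxu.trans ?_
    rw [div_le_iff₀ (by positivity)]
    nlinarith
  have hgap : ∀ y, CoordDescent.quadratic Q (Q *ᵥ z) y - CoordDescent.quadratic Q (Q *ᵥ z) z
      = (y - z) ⬝ᵥ (Q *ᵥ (y - z)) := CoordDescent.quadratic_sub_quadratic hQ z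
  have hEpos : 0 < (x₀ - z) ⬝ᵥ (Q *ᵥ (x₀ - z)) := by
    rw [hz]
    refine lt_of_lt_of_le ?_ hE0
    have : 0 < (n : ℝ) ^ 2 - 1 := by nlinarith
    positivity
  rw [← hz] at hray
  have hlow : ∀ k : ℕ, (1 - x) ^ (2 * k) * ((x₀ - z) ⬝ᵥ (Q *ᵥ (x₀ - z)))
      ≤ CoordDescent.quadratic Q (Q *ᵥ z)
          (CoordDescent.sGSIterate (CoordDescent.quadratic Q (Q *ᵥ z)) x₀ k)
        - CoordDescent.quadratic Q (Q *ᵥ z) z := by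
    intro k
    rw [hgap, CoordDescent.sGSIterate_sub hQ hd]
    exact CoordDescent.rayleigh_sGS_iterate hQ hd hpos (by linarith) k _ hray
  refine ⟨Q *ᵥ z, CoordDescent.quadratic Q (Q *ᵥ z) z, ⟨⟨z, rfl⟩, ?_⟩, ?_, ?_, ?_⟩
  · rintro _ ⟨y, rfl⟩
    exact sub_nonneg.1 ((hpos _).trans_eq (hgap y).symm)
  · exact sub_pos.1 (hEpos.trans_eq (hgap x₀).symm)
  · intro k
    refine le_trans ?_ (hlow k)
    rw [hgap]
    refine mul_le_mul_of_nonneg_right ?_ hEpos.le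
    have h1 : (1 - x) ^ (2 * k + 2) ≤ (1 - x) ^ (2 * k) :=
      pow_le_pow_of_le_one (by linarith) (by linarith) (by omega)
    have h2 : 0 ≤ (1 - x) ^ (2 * k + 2) := pow_nonneg (by linarith) _
    nlinarith
  · intro ε hε hε2 k hk
    rw [hgap x₀] at hk ⊢
    have hpow : (1 - x) ^ (2 * k) ≤ ε := le_of_mul_le_mul_right ((hlow k).trans hk) hEpos
    have hlog := CoordDescent.log_inv_le_of_pow_le hx0 hx1 hε hpow
    set L := Real.log ε⁻¹ with hL
    have hL2 : 1 / 2 ≤ L := by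
      have h1 : Real.log 2 ≤ L := by
        refine Real.log_le_log (by norm_num) ?_
        rw [le_inv_comm₀ (by norm_num) hε]
        linarith
      linarith [Real.log_two_gt_d9]
    -- `log (1 / ε) / (1 - c)` epochs of the randomized method reach accuracy `ε`
    refine ⟨⌈L / (1 - c)⌉₊, ?_, ?_⟩
    · have h1 : (⌈L / (1 - c)⌉₊ : ℝ) ≤ 2 * (L / (1 - c)) := by
        have h2 := (Nat.ceil_lt_add_one (a := L / (1 - c)) (by positivity)).le
        have h3 : 1 ≤ L / (1 - c) := by
          rw [le_div_iff₀ hη]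
          linarith
        linarith
      have h4 : L ≤ 4 * (80 * (1 - c) / (n : ℝ) ^ 2) * k := hlog.trans (by gcongr)
      calc 1 / 640 * (n : ℝ) ^ 2 * (⌈L / (1 - c)⌉₊ : ℝ)
          ≤ 1 / 640 * (n : ℝ) ^ 2 * (2 * (L / (1 - c))) := by gcongr
        _ ≤ 1 / 640 * (n : ℝ) ^ 2 * (2 * (4 * (80 * (1 - c) / (n : ℝ) ^ 2) * k / (1 - c))) := by
            gcongr
        _ = k := by
            field_simp
            norm_num
    · have hηn : 1 - c ≤ (n : ℝ) := by linarith
      refine (CoordDescent.rcdExpectedValue_sub_le hQ hd hn0 hηn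
        (CoordDescent.energy_le_sum_mulVec_sq hc0.le hc1.le) z x₀ _).trans ?_
      refine mul_le_mul_of_nonneg_right ?_ hEpos.le
      refine (CoordDescent.one_sub_div_pow_le_exp n _ hn0 hηn).trans ?_
      rw [← Real.le_log_iff_exp_le hε, neg_le, ← Real.log_inv, ← hL, mul_comm]
      exact (div_le_iff₀ hη).1 (Nat.le_ceil _)
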